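/- Let $R$ be a Noetherian local ring with infinite residue field and let $I$ be an ideal of $R$. A reduction of $I$ is an ideal $J\subseteq I$ with $I^{r+1}=JI^r$ for some $r\ge 0$; a minimal reduction is a reduction that is minimal with respect to inclusion; and $\operatorname{core}(I)$ is the intersection of all reductions of $I$. Let $\mathcal M(I)$ be the set of minimal reductions of $I$, put $\mathcal P(I)=\bigcup_{J\in\mathcal M(I)}\operatorname{Ass}_R(I/J)\subseteq\operatorname{Spec}(R)$, and let $$\gamma(I)=\inf\Big\{\,t\ge 1 \;\Big|\; \operatorname{core}(I)=\bigcap_{i=1}^t J_i \text{ for some } J_1,\dots,J_t\in\mathcal M(I)\Big\}\in\mathbb N\cup\{\infty\}.$$ For an ideal $\mathfrak a$ of a Noetherian local ring $(A,\mathfrak n)$ let $\mu(\mathfrak a)$ be its minimal number of generators and let $\ell(\mathfrak a)=\dim A[\mathfrak a t]/\mathfrak n A[\mathfrak a t]$ be its analytic spread. Assume that $\mathcal P(I)$ is finite, that every element of $\mathcal P(I)$ is minimal in this set with respect to inclusion, and that $\mu(I_{\mathfrak q})=\ell(I_{\mathfrak q})$ for every prime $\mathfrak q\in\operatorname{Spec}(R)\setminus\overline{\mathcal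 P(I)}$, where $\overline{\mathcal P(I)}$ is the closure in the Zariski topology. Then $\gamma(I)<\infty$, that is, $\operatorname{core}(I)$ is an intersection of finitely many minimal reductions of $I$. -/

import Mathlib

namespace Ideal

/-- `J` is a reduction of `I`: `J ⊆ I` and `I ^ (r + 1) = J * I ^ r` for some `r ≥ 0`. -/
def IsReduction {R : Type*} [CommRing R] (J I : Ideal R) : Prop :=
  J ≤ I ∧ ∃ r : ℕ, I ^ (r + 1) = J * I ^ r

/-- `J` is a minimal reduction of `I`: minimal under inclusion among the reductions of `I`. -/
def IsMinimalReduction {R : Type*} [CommRing R] (J I : Ideal R) : Prop :=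
  Minimal (fun J' : Ideal R => J'.IsReduction I) J

/-- The core of `I`: the intersection of all reductions of `I`. -/
def core {R : Type*} [CommRing R] (I : Ideal R) : Ideal R :=
  sInf {J : Ideal R | J.IsReduction I}

/-- The special fiber ring `R[It] / 𝔪 R[It]` (which is `⨁ Iⁿ / 𝔪 Iⁿ`) of an ideal `I` of a local
ring `(R, 𝔪)`. -/
abbrev SpecialFiber {R : Type*} [CommRing R] [IsLocalRing R] (I : Ideal R) : Type _ :=
  reesAlgebra I ⧸ (IsLocalRing.maximalIdeal R).map (algebraMap R (reesAlgebra I))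

/-- The analytic spread of an ideal of a local ring: the Krull dimension of its special fiber
ring. -/
noncomputable def analyticSpread {R : Type*} [CommRing R] [IsLocalRing R] (I : Ideal R) :
    WithBot ℕ∞ :=
  ringKrullDim I.SpecialFiber

/-- The set of primes `𝔭` that are associated to the `R`-module `I / J` for some minimal
reduction `J` of `I`. -/
def reductionPrimes {R : Type*} [CommRing R] (I : Ideal R) : Set (PrimeSpectrum R) :=
  {p | ∃ J : Ideal R, J.IsMinimalReduction I ∧
    p.asIdeal ∈ associatedPrimes R (I ⧸ J.submoduleOf I)}

/-- The least number `t ≥ 1` such that the core of `I` is an intersection of `t` minimal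
reductions of `I`; it is `⊤` if there is no such `t`. -/
noncomputable def gamma {R : Type*} [CommRing R] (I : Ideal R) : ℕ∞ :=
  sInf {t : ℕ∞ | ∃ n : ℕ, t = n ∧ 0 < n ∧ ∃ J : Fin n → Ideal R,
    (∀ i, (J i).IsMinimalReduction I) ∧ I.core = ⨅ i, J i}

end Ideal

open IsLocalRing


/-! Let `c` be the vanishing ideal of 𝒫(I) and `T` the set of elements outside all primes of 𝒫(I).
Elements of `T` are nonzerodivisors on I/J for each minimal reduction J, so membership in J of
elements of I can be tested after inverting `T`. As 𝒫(I) is finite with incomparable members,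
R_T/c^N R_T is Artinian for every N. Suppose one N satisfies c^N I ⊆ J for all reductions J. Then
the finite intersections of minimal reductions lie between c^N I and I, and one of them, K, has
minimal extension to R_T. Intersecting K with a further minimal reduction does not change that
extension, hence does not change K, so K is the core.

The uniform N is the main point (`exists_pow_mul_le_combinationIdeal`). Where μ = ℓ, the special
fiber is a polynomial ring, so I is generated by analytically independent elements and has no proper
reduction, even after flat base change (`AnalyticallyIndependent.of_flat`,
`AnalyticallyIndependent.le_of_pow_succ_le`). To treat all reductions at once, take m linear
combinations of m generators with indeterminate coefficients X_ij. The colons of this generic ideal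
by c^n I R[X] form an ascending chain; it stabilizes, and specializing the X_ij gives one exponent
for every reduction generated by such combinations. By Nakayama every reduction contains one of
these. -/

/-- A family `f` is analytically independent modulo the ideal `q` if the coefficients of every
homogeneous polynomial relation among the `f i` lie in `q`. -/
def AnalyticallyIndependent {A ι : Type*} [CommRing A] (q : Ideal A) (f : ι → A) : Prop :=
  ∀ (r : ℕ) (P : MvPolynomial ι A), P.IsHomogeneous r → MvPolynomial.aeval f P = 0 →
    ∀ α, P.coeff α ∈ q

/-! ### The special fiber ring and analytic independence. -/

section SpecialFiber

variable {A : Type*} [CommRing A]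

/-- The element `x t` of the Rees algebra, for `x ∈ I`. -/
noncomputable def Ideal.reesMonomial (I : Ideal A) (x : I) : reesAlgebra I :=
  ⟨Polynomial.monomial 1 (x : A), reesAlgebra.monomial_mem.2 (by simp)⟩

theorem Ideal.adjoin_reesMonomial {ι : Type*} (I : Ideal A) (f : ι → I)
    (hf : Ideal.span (Set.range fun i => (f i : A)) = I) :
    Algebra.adjoin A (Set.range fun i => I.reesMonomial (f i)) = ⊤ := by
  have key : Algebra.adjoin A (Set.range fun i => (Polynomial.monomial 1 (f i : A))) =
      reesAlgebra I := by
    rw [← adjoin_monomial_eq_reesAlgebra]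
    apply le_antisymm
    · apply Algebra.adjoin_mono
      rintro _ ⟨i, rfl⟩
      exact ⟨f i, (f i).2, rfl⟩
    · apply Algebra.adjoin_le
      conv_lhs => rw [← hf]
      rw [Ideal.span, Submodule.map_span]
      change _ ≤ ((Algebra.adjoin A _).toSubmodule : Submodule A (Polynomial A))
      rw [Submodule.span_le]
      rintro _ ⟨_, ⟨i, rfl⟩, rfl⟩
      exact Algebra.subset_adjoin ⟨i, rfl⟩
  apply Subalgebra.map_injective (f := (reesAlgebra I).val) Subtype.val_injective
  rw [AlgHom.map_adjoin, ← Set.range_comp, Algebra.map_top, Subalgebra.range_val]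
  exact key

/-- Homogeneity puts everything in one degree, so relations among the `f i` lift to relations among
the Rees algebra elements `f i` t. -/
theorem MvPolynomial.IsHomogeneous.aeval_monomial_one {σ : Type*} {r : ℕ} {P : MvPolynomial σ A}
    (hP : P.IsHomogeneous r) (f : σ → A) :
    MvPolynomial.aeval (fun i => Polynomial.monomial 1 (f i)) P =
      Polynomial.monomial r (MvPolynomial.aeval f P) := by
  rw [MvPolynomial.aeval_def, MvPolynomial.aeval_def, MvPolynomial.eval₂_eq,
    MvPolynomial.eval₂_eq, map_sum]
  refine Finset.sum_congr rfl fun α hα => ?_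
  have hr : α.degree = r := by
    by_contra h
    exact (MvPolynomial.mem_support_iff.1 hα) (hP.coeff_eq_zero h)
  simp only [← Polynomial.C_mul_X_pow_eq_monomial, mul_pow,
    Finset.prod_mul_distrib, Finset.prod_pow_eq_pow_sum]
  rw [← hr, Finsupp.degree_apply]
  simp [mul_assoc]

/-- A nonzero kernel element is a nonzerodivisor, so dividing by it lowers the dimension `n` by at
least one, leaving no room for a surjection onto `F`. -/
theorem MvPolynomial.injective_of_surjective_of_ringKrullDim_eq {k F : Type*} [Field k]
    [CommRing F] {n : ℕ} (ψ : MvPolynomial (Fin n) k →+* F) (hψ : Function.Surjective ψ)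
    (hn : (n : WithBot ℕ∞) = ringKrullDim F) : Function.Injective ψ := by
  rw [injective_iff_map_eq_zero]
  intro P hP
  by_contra hne
  let θ : (MvPolynomial (Fin n) k ⧸ Ideal.span {P}) →+* F :=
    Ideal.Quotient.lift _ ψ (by
      intro a ha
      obtain ⟨b, rfl⟩ := Ideal.mem_span_singleton.1 ha
      rw [map_mul, hP, zero_mul])
  have h1 := ringKrullDim_le_of_surjective θ
    (Ideal.Quotient.lift_surjective_of_surjective _ _ hψ)
  have h2 := ringKrullDim_quotient_succ_le_of_nonZeroDivisor
    (mem_nonZeroDivisors_of_ne_zero hne)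
  rw [MvPolynomial.ringKrullDim_of_isNoetherianRing, ringKrullDim_eq_zero_of_field, zero_add,
    Nat.card_fin] at h2
  have h3 : (n : WithBot ℕ∞) + 1 ≤ n := by
    refine le_trans ?_ h2
    conv_lhs => rw [hn]
    exact add_le_add_left h1 1
  have h4 : ((n + 1 : ℕ) : WithBot ℕ∞) ≤ (n : ℕ) := by exact_mod_cast h3
  have h5 : n + 1 ≤ n := by exact_mod_cast h4
  omega

/-- If `n` elements generate an algebra of Krull dimension `n` over the residue field, then they
satisfy no nontrivial polynomial relation. -/
theorem coeff_mem_maximalIdeal_of_ringKrullDim_eq [IsLocalRing A] {F : Type*} [CommRing F]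
    [Algebra A F] (hm : ∀ a ∈ maximalIdeal A, algebraMap A F a = 0) {n : ℕ} (u : Fin n → F)
    (hφs : Function.Surjective (MvPolynomial.aeval (R := A) u))
    (hn : (n : WithBot ℕ∞) = ringKrullDim F) (P : MvPolynomial (Fin n) A)
    (hφP : MvPolynomial.aeval u P = 0) (α : Fin n →₀ ℕ) : P.coeff α ∈ maximalIdeal A := by
  let c : ResidueField A →+* F := Ideal.Quotient.lift (maximalIdeal A) (algebraMap A F) hm
  let ψ : MvPolynomial (Fin n) (ResidueField A) →+* F := MvPolynomial.eval₂Hom c u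
  have hψ : ∀ Q, ψ (MvPolynomial.map (residue A) Q) = MvPolynomial.aeval u Q := fun Q => by
    rw [MvPolynomial.coe_eval₂Hom, MvPolynomial.eval₂_map]; rfl
  have hψs : Function.Surjective ψ := fun y => by
    obtain ⟨Q, rfl⟩ := hφs y
    exact ⟨_, hψ Q⟩
  have h := (injective_iff_map_eq_zero ψ).1
    (MvPolynomial.injective_of_surjective_of_ringKrullDim_eq ψ hψs hn) _ ((hψ P).trans hφP)
  rw [← residue_eq_zero_iff, ← MvPolynomial.coeff_map, h, MvPolynomial.coeff_zero]

theorem coeff_mem_maximalIdeal_of_adjoin_eq_top [IsLocalRing A] {B : Type*} [CommRing B]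
    [Algebra A B] {n : ℕ} (v : Fin n → B) (hv : Algebra.adjoin A (Set.range v) = ⊤)
    (hn : (n : WithBot ℕ∞) = ringKrullDim (B ⧸ (maximalIdeal A).map (algebraMap A B)))
    (P : MvPolynomial (Fin n) A) (hP : MvPolynomial.aeval v P = 0) (α : Fin n →₀ ℕ) :
    P.coeff α ∈ maximalIdeal A := by
  let π := Ideal.Quotient.mkₐ A ((maximalIdeal A).map (algebraMap A B))
  have hπ : (MvPolynomial.aeval fun i => π (v i) :
      MvPolynomial (Fin n) A →ₐ[A] _) = π.comp (MvPolynomial.aeval (R := A) v) :=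
    (MvPolynomial.comp_aeval v π).symm
  refine coeff_mem_maximalIdeal_of_ringKrullDim_eq (fun a ha => ?_) (fun i => π (v i)) ?_ hn P ?_ α
  · exact Ideal.Quotient.eq_zero_iff_mem.2 (Ideal.mem_map_of_mem _ ha)
  · rw [hπ]
    have h : Function.Surjective (MvPolynomial.aeval (R := A) v) := by
      rw [← AlgHom.range_eq_top, ← Algebra.adjoin_range_eq_range_aeval, hv]
    exact (Ideal.Quotient.mkₐ_surjective A _).comp h
  · rw [hπ, AlgHom.comp_apply, hP, map_zero]

/-- A minimal number of generators of an ideal whose analytic spread equals that number is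
analytically independent. -/
theorem analyticallyIndependent_of_analyticSpread [IsLocalRing A] {n : ℕ} (I : Ideal A)
    (f : Fin n → A) (hf : Ideal.span (Set.range f) = I)
    (hn : (n : WithBot ℕ∞) = I.analyticSpread) :
    AnalyticallyIndependent (maximalIdeal A) f := by
  intro r P hP h0
  let g : Fin n → I := fun i => ⟨f i, hf ▸ Ideal.subset_span ⟨i, rfl⟩⟩
  refine coeff_mem_maximalIdeal_of_adjoin_eq_top _ (I.adjoin_reesMonomial g hf) hn P ?_
  apply Subtype.val_injective
  have := congrArg (fun ψ => ψ P) (MvPolynomial.comp_aeval (R := A)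
    (fun i => I.reesMonomial (g i)) (reesAlgebra I).val)
  refine Eq.trans this ((hP.aeval_monomial_one f).trans ?_)
  rw [h0, map_zero]; rfl

end SpecialFiber

/-! ### Analytic independence, flat base change and reductions. -/

/-- By the equational criterion of flatness, the coefficients of a relation over `C` are
`C`-combinations of the coefficients of homogeneous relations over `R`, and the latter lie in `q`.
-/
theorem AnalyticallyIndependent.of_flat {R C ι : Type*} [CommRing R] [CommRing C] [Algebra R C]
    [Module.Flat R C] {q : Ideal R} {f : ι → R} (hf : AnalyticallyIndependent q f) {M : Ideal C}
    (hM : q ≤ M.comap (algebraMap R C)) :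
    AnalyticallyIndependent M (fun i => algebraMap R C (f i)) := by
  intro r P hP h0 α
  by_cases hα : α ∈ P.support
  swap
  · rw [MvPolynomial.notMem_support_iff.1 hα]; exact M.zero_mem
  have hrel : ∑ β : P.support, (∏ i ∈ β.1.support, f i ^ β.1 i) • P.coeff β.1 = (0 : C) := by
    rw [← h0, MvPolynomial.aeval_def, MvPolynomial.eval₂_eq]
    refine (Finset.sum_coe_sort P.support
      (fun β => (∏ i ∈ β.support, f i ^ β i) • P.coeff β)).trans ?_
    refine Finset.sum_congr rfl fun β _ => ?_
    rw [Algebra.smul_def, mul_comm, map_prod]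
    simp [map_pow]
  obtain ⟨κ, a, y, hy, ha⟩ := Module.Flat.isTrivialRelation_of_sum_smul_eq_zero (R := R) (M := C) hrel
  rw [show P.coeff α = _ from hy ⟨α, hα⟩]
  refine M.sum_mem fun j _ => ?_
  rw [Algebra.smul_def]
  refine M.mul_mem_right _ (hM ?_)
  let Pj : MvPolynomial ι R := ∑ β : P.support, MvPolynomial.monomial β.1 (a β j)
  have hPj : Pj.IsHomogeneous r := by
    refine MvPolynomial.IsHomogeneous.sum _ _ _ fun β _ =>
      MvPolynomial.isHomogeneous_monomial _ ?_
    by_contra h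
    exact (MvPolynomial.mem_support_iff.1 β.2) (hP.coeff_eq_zero h)
  have hPj0 : MvPolynomial.aeval f Pj = 0 := by
    rw [map_sum, ← ha j]
    refine Finset.sum_congr rfl fun β _ => ?_
    rw [MvPolynomial.aeval_monomial, mul_comm]; rfl
  have hc : Pj.coeff α = a ⟨α, hα⟩ j := by
    classical
    rw [MvPolynomial.coeff_sum, Finset.sum_eq_single ⟨α, hα⟩]
    · simp
    · intro β _ hβ
      rw [MvPolynomial.coeff_monomial, if_neg (fun h => hβ (Subtype.ext h))]
    · simp
  rw [← hc]
  exact hf r Pj hPj hPj0 α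

/-- An ideal generated by an analytically independent family has no proper reductions. -/
theorem AnalyticallyIndependent.le_of_pow_succ_le {C ι : Type*} [CommRing C] [IsLocalRing C]
    [Finite ι] {f : ι → C} (hf : AnalyticallyIndependent (maximalIdeal C) f) {J : Ideal C}
    (hJ : J ≤ Ideal.span (Set.range f)) {r : ℕ}
    (hr : Ideal.span (Set.range f) ^ (r + 1) ≤ J * Ideal.span (Set.range f) ^ r) :
    Ideal.span (Set.range f) ≤ J := by
  classical
  cases nonempty_fintype ι
  set I := Ideal.span (Set.range f) with hI
  -- the reductions of the coefficient vectors of elements of `J`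
  let L : (ι → C) →ₗ[C] C := Fintype.linearCombination C f
  have hLr : LinearMap.range L = I := Fintype.range_linearCombination C f
  let ρ : (ι → C) →ₗ[C] (ι → ResidueField C) :=
    (Algebra.linearMap C (ResidueField C)).compLeft ι
  let W : Submodule C (ι → ResidueField C) := (Submodule.comap L J).map ρ
  let V : Submodule (ResidueField C) (ι → ResidueField C) :=
    { W.toAddSubmonoid with
      smul_mem' := by
        intro c x hx
        obtain ⟨c, rfl⟩ := residue_surjective c
        exact W.smul_mem c hx }
  have hev : ∀ (lam : ι → ResidueField C) (s : ℕ) (P : MvPolynomial ι C), P.IsHomogeneous s →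
      MvPolynomial.aeval f P = 0 → MvPolynomial.aeval lam P = 0 := by
    intro lam s P hP h0
    rw [MvPolynomial.aeval_def, MvPolynomial.eval₂_eq]
    refine Finset.sum_eq_zero fun α _ => ?_
    have := (residue_eq_zero_iff _).2 (hf s P hP h0 α)
    rw [ResidueField.algebraMap_eq, this, zero_mul]
  -- Otherwise a nonzero functional `φ` kills `V`; view it as a point `lam`. Homogeneous relations
  -- among the `f i` vanish at `lam` by independence, and elements of `J * I ^ r` have representing
  -- forms vanishing there. Since `f i ^ (r + 1)` is such an element, `lam i ^ (r + 1) = 0` for all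
  -- `i`, so `φ = 0`.
  have hV : V = ⊤ := by
    by_contra hne
    obtain ⟨φ, hφ, hφV⟩ := Submodule.exists_le_ker_of_lt_top V (lt_top_iff_ne_top.2 hne)
    let lam : ι → ResidueField C := fun i => φ (Pi.single i 1)
    have hlam : ∀ c : ι → C, φ (ρ c) = ∑ i, residue C (c i) * lam i := by
      intro c
      rw [LinearMap.pi_apply_eq_sum_univ φ]
      refine Finset.sum_congr rfl fun i _ => ?_
      rw [smul_eq_mul]
      congr 2
      ext j; simp [Pi.single_apply, eq_comm]
    have hJP : ∀ x ∈ J * I ^ r, ∃ P : MvPolynomial ι C, P.IsHomogeneous (r + 1) ∧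
        MvPolynomial.aeval f P = x ∧ MvPolynomial.aeval lam P = 0 := by
      intro x hx
      induction hx using Submodule.mul_induction_on' with
      | mem_mul_mem a ha b hb =>
        obtain ⟨c, hc⟩ : a ∈ LinearMap.range L := hLr ▸ hJ ha
        obtain ⟨Q, hQ, rfl⟩ := (Ideal.mem_span_pow_iff_exists_isHomogeneous f b).1 hb
        refine ⟨(∑ i, MvPolynomial.C (c i) * MvPolynomial.X i) * Q, ?_, ?_, ?_⟩
        · rw [add_comm]
          exact (MvPolynomial.IsHomogeneous.sum _ _ _ fun i _ =>
            MvPolynomial.isHomogeneous_C_mul_X _ _).mul hQ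
        · rw [map_mul, ← hc]
          congr 1
          simp [L, Fintype.linearCombination_apply]
        · have h1 : φ (ρ c) = 0 := hφV (show ρ c ∈ W from ⟨c, by simpa [hc] using ha, rfl⟩)
          rw [hlam] at h1
          rw [map_mul, map_sum]
          simp only [map_mul, MvPolynomial.aeval_C, MvPolynomial.aeval_X,
            ResidueField.algebraMap_eq, h1, zero_mul]
      | add a _ b _ hP hQ =>
        obtain ⟨P, hP, hP1, hP2⟩ := hP
        obtain ⟨Q, hQ, hQ1, hQ2⟩ := hQ
        exact ⟨P + Q, hP.add hQ, by rw [map_add, hP1, hQ1], by rw [map_add, hP2, hQ2, add_zero]⟩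
    have hlam0 : ∀ i, lam i = 0 := by
      intro i
      obtain ⟨P, hP, hP1, hP2⟩ := hJP (f i ^ (r + 1))
        (hr (Ideal.pow_mem_pow (Ideal.subset_span (Set.mem_range_self i)) _))
      have := hev lam (r + 1) (MvPolynomial.X i ^ (r + 1) - P)
        ((MvPolynomial.isHomogeneous_X_pow i (r + 1)).sub hP) (by
          rw [map_sub, hP1, map_pow, MvPolynomial.aeval_X, sub_self])
      rw [map_sub, hP2, sub_zero, map_pow, MvPolynomial.aeval_X] at this
      exact pow_eq_zero_iff (Nat.succ_ne_zero r) |>.1 this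
    apply hφ
    ext i
    simpa [lam] using hlam0 i
  -- Nakayama: as `V` is everything, each `f i` lies in `J` up to a combination with coefficients in
  -- the maximal ideal.
  refine Submodule.le_of_le_smul_of_le_jacobson_bot (I := maximalIdeal C)
    (Submodule.fg_span (Set.finite_range f)) (maximalIdeal_le_jacobson _) ?_
  rw [hI, Ideal.span, Submodule.span_le]
  rintro _ ⟨i, rfl⟩
  obtain ⟨c, hc, hci⟩ : ρ (Pi.single i 1) ∈ W := by
    have : ρ (Pi.single i 1) ∈ V := hV ▸ Submodule.mem_top
    exact this
  have h1 : f i = L c + L (Pi.single i 1 - c) := by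
    rw [map_sub]; simp [L, Fintype.linearCombination_apply, Pi.single_apply]
  rw [h1]
  refine Submodule.add_mem_sup hc ?_
  rw [Fintype.linearCombination_apply]
  refine Submodule.sum_mem _ fun j _ => Submodule.smul_mem_smul ?_ (Submodule.subset_span ⟨j, rfl⟩)
  have := congrFun hci j
  rw [← residue_eq_zero_iff, Pi.sub_apply, map_sub, sub_eq_zero]
  exact this.symm

theorem Ideal.FG.exists_notMem_mul_mem_of_map_le {S : Type*} [CommRing S] {Q : Ideal S}
    [Q.IsPrime] {b : Ideal S} (hb : b.FG) {c : Ideal S}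
    (h : b.map (algebraMap S (Localization.AtPrime Q)) ≤
      c.map (algebraMap S (Localization.AtPrime Q))) :
    ∃ u ∉ Q, ∀ z ∈ b, u * z ∈ c := by
  classical
  obtain ⟨s, rfl⟩ := hb
  have h1 : ∀ z : s, ∃ m ∈ Q.primeCompl, m * z.1 ∈ c := fun z =>
    (IsLocalization.algebraMap_mem_map_algebraMap_iff Q.primeCompl (Localization.AtPrime Q) c
      z.1).1 (h (Ideal.mem_map_of_mem _ (Submodule.subset_span z.2)))
  choose m hm hmc using h1
  refine ⟨∏ z, m z, Q.primeCompl.prod_mem fun z _ => hm z, fun z hz => ?_⟩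
  have : Submodule.span S (s : Set S) ≤ Submodule.comap (LinearMap.mulLeft S (∏ z, m z)) c := by
    rw [Submodule.span_le]
    intro z hz
    obtain ⟨w, hw⟩ := Finset.dvd_prod_of_mem m (Finset.mem_univ (⟨z, hz⟩ : s))
    change (∏ z, m z) * z ∈ c
    rw [hw, mul_right_comm]
    exact c.mul_mem_right _ (hmc ⟨z, hz⟩)
  exact this hz

/-- Over a flat algebra, a reduction of an ideal that is locally generated by an analytically
independent family agrees locally with the ideal. -/
theorem AnalyticallyIndependent.exists_notMem_mul_mem {R S : Type*} [CommRing R] [CommRing S]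
    [Algebra R S] [Module.Flat R S] {I : Ideal R} (hI : I.FG) {J : Ideal S}
    (hJ : J ≤ I.map (algebraMap R S)) (Q : Ideal S) [Q.IsPrime] {r : ℕ} {s : S} (hs : s ∉ Q)
    (hred : ∀ x ∈ (I ^ (r + 1)).map (algebraMap R S), s * x ∈ J * (I ^ r).map (algebraMap R S))
    {n : ℕ} {f : Fin n → R} (hf : AnalyticallyIndependent (Q.comap (algebraMap R S)) f)
    (hfI : ∀ i, f i ∈ I) {t : R} (ht : t ∉ Q.comap (algebraMap R S))
    (htI : ∀ x ∈ I, t * x ∈ Ideal.span (Set.range f)) :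
    ∃ u ∉ Q, ∀ z ∈ I.map (algebraMap R S), u * z ∈ J := by
  let C := Localization.AtPrime Q
  have : Module.Flat R C := Module.Flat.trans R S C
  have hRC : algebraMap R C = (algebraMap S C).comp (algebraMap R S) :=
    IsScalarTower.algebraMap_eq R S C
  have hF := hf.of_flat (C := C) (M := maximalIdeal C) (by
    rw [hRC, ← Ideal.comap_comap]
    exact Ideal.comap_mono (IsLocalization.AtPrime.under_maximalIdeal C Q).ge)
  have hspan : Ideal.span (Set.range fun i => algebraMap R C (f i)) = I.map (algebraMap R C) := by
    apply le_antisymm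
    · rw [Ideal.span_le]
      rintro _ ⟨i, rfl⟩
      exact Ideal.mem_map_of_mem _ (hfI i)
    · rw [Ideal.map_le_iff_le_comap]
      intro x hx
      have h1 : algebraMap R C (t * x) ∈ (Ideal.span (Set.range f)).map (algebraMap R C) :=
        Ideal.mem_map_of_mem _ (htI x hx)
      rw [Ideal.map_span, ← Set.range_comp, map_mul] at h1
      refine (Ideal.unit_mul_mem_iff_mem (Ideal.span (Set.range (algebraMap R C ∘ f))) ?_).1 h1
      rw [hRC]
      exact IsLocalization.map_units C (⟨algebraMap R S t, ht⟩ : Q.primeCompl)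
  have key := hF.le_of_pow_succ_le (J := J.map (algebraMap S C)) (r := r) (by
    rw [hspan, hRC, ← Ideal.map_map]
    exact Ideal.map_mono hJ) (by
    rw [hspan, ← Ideal.map_pow, ← Ideal.map_pow, hRC, ← Ideal.map_map, ← Ideal.map_map,
      ← Ideal.map_mul, Ideal.map_le_iff_le_comap]
    intro x hx
    exact (IsLocalization.algebraMap_mem_map_algebraMap_iff Q.primeCompl C _ _).2
      ⟨s, hs, hred x hx⟩)
  rw [hspan, hRC, ← Ideal.map_map] at key
  exact (hI.map _).exists_notMem_mul_mem_of_map_le key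

/-- Minimal generators of the localized ideal are multiplied by units to come from `I`; `t` is a
common denominator for finitely many generators of `I`. -/
theorem exists_analyticallyIndependent_of_spanFinrank_eq {R : Type*} [CommRing R]
    [IsNoetherianRing R] (I : Ideal R) (q : Ideal R) [q.IsPrime]
    (h : ((I.map (algebraMap R (Localization.AtPrime q))).spanFinrank : WithBot ℕ∞) =
        (I.map (algebraMap R (Localization.AtPrime q))).analyticSpread) :
    ∃ (n : ℕ) (f : Fin n → R), AnalyticallyIndependent q f ∧ (∀ i, f i ∈ I) ∧
      ∃ t ∉ q, ∀ x ∈ I, t * x ∈ Ideal.span (Set.range f) := by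
  let A := Localization.AtPrime q
  have hfg : (I.map (algebraMap R A)).FG := Ideal.FG.map (IsNoetherian.noetherian I) _
  obtain ⟨s, hs, hspan⟩ := Submodule.FG.exists_span_finset_card_eq_spanFinrank hfg
  have h1 : ∀ i : Fin s.card, ∃ x ∈ I, ∃ m ∈ q.primeCompl,
      (s.equivFin.symm i : A) * algebraMap R A m = algebraMap R A x := fun i => by
    have : (s.equivFin.symm i : A) ∈ I.map (algebraMap R A) :=
      hspan ▸ Submodule.subset_span (s.equivFin.symm i).2
    obtain ⟨⟨x, m⟩, hx⟩ := (IsLocalization.mem_map_algebraMap_iff q.primeCompl A).1 this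
    exact ⟨x, x.2, m, m.2, hx⟩
  choose f hfI m hm hfm using h1
  have hspan' : Ideal.span (Set.range fun i => algebraMap R A (f i)) =
      I.map (algebraMap R A) := by
    apply le_antisymm
    · rw [Ideal.span_le]
      rintro _ ⟨i, rfl⟩
      exact Ideal.mem_map_of_mem _ (hfI i)
    · rw [← hspan, Submodule.span_le]
      intro z hz
      have h2 : z * algebraMap R A (m (s.equivFin ⟨z, hz⟩)) ∈
          Ideal.span (Set.range fun i => algebraMap R A (f i)) := by
        have := hfm (s.equivFin ⟨z, hz⟩)
        rw [Equiv.symm_apply_apply] at this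
        rw [this]
        exact Ideal.subset_span ⟨_, rfl⟩
      exact (Ideal.mul_unit_mem_iff_mem _
        (IsLocalization.map_units A (⟨_, hm (s.equivFin ⟨z, hz⟩)⟩ : q.primeCompl))).1 h2
  have hind := analyticallyIndependent_of_analyticSpread _ _ hspan' (hs ▸ h)
  refine ⟨s.card, f, ?_, hfI, ?_⟩
  · intro r P hP h0 α
    have := hind r (MvPolynomial.map (algebraMap R A) P) (hP.map _) (by
      have h3 := MvPolynomial.map_aeval f (algebraMap R A) P
      rw [h0, map_zero] at h3
      rw [MvPolynomial.aeval_def, MvPolynomial.eval₂_map]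
      exact h3.symm) α
    rw [MvPolynomial.coeff_map] at this
    exact (IsLocalization.AtPrime.to_map_mem_maximal_iff A q _).1 this
  · refine Ideal.FG.exists_notMem_mul_mem_of_map_le (Q := q) (IsNoetherian.noetherian I) ?_
    rw [Ideal.map_span, ← Set.range_comp]
    exact hspan'.ge

/-! ### Generic linear combinations and a uniform exponent. -/

section Generic

variable {R : Type*} [CommRing R] {m : ℕ}

/-- The ideal generated by the `m` linear combinations of `g 0, …, g (m - 1)` with
coefficients `a (i, j)`. -/
def combinationIdeal (g : Fin m → R) (a : Fin m × Fin m → R) : Ideal R :=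
  Ideal.span (Set.range fun i => ∑ j, a (i, j) * g j)

/-- The ideal generated by `m` generic linear combinations of `g 0, …, g (m - 1)`. -/
noncomputable def genericIdeal (g : Fin m → R) : Ideal (MvPolynomial (Fin m × Fin m) R) :=
  combinationIdeal (fun j => MvPolynomial.C (g j)) MvPolynomial.X

theorem genericIdeal_le (g : Fin m → R) :
    genericIdeal g ≤ (Ideal.span (Set.range g)).map MvPolynomial.C := by
  rw [genericIdeal, combinationIdeal, Ideal.span_le]
  rintro _ ⟨i, rfl⟩
  exact Ideal.sum_mem _ fun j _ => Ideal.mul_mem_left _ _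
    (Ideal.mem_map_of_mem _ (Ideal.subset_span ⟨j, rfl⟩))

theorem genericIdeal_le_comap_eval (g : Fin m → R) (a : Fin m × Fin m → R) :
    genericIdeal g ≤ (combinationIdeal g a).comap (MvPolynomial.eval a) := by
  rw [genericIdeal, combinationIdeal, Ideal.span_le]
  rintro _ ⟨i, rfl⟩
  refine Ideal.subset_span ⟨i, ?_⟩
  simp

theorem map_combinationIdeal_le (g : Fin m → R) (a : Fin m × Fin m → R)
    {M : Ideal (MvPolynomial (Fin m × Fin m) R)}
    (hM : ∀ k, MvPolynomial.X k - MvPolynomial.C (a k) ∈ M) :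
    (combinationIdeal g a).map MvPolynomial.C ≤
      genericIdeal g ⊔ M * (Ideal.span (Set.range g)).map MvPolynomial.C := by
  rw [combinationIdeal, Ideal.map_span, Ideal.span_le]
  rintro _ ⟨_, ⟨i, rfl⟩, rfl⟩
  have h : MvPolynomial.C (∑ j, a (i, j) * g j) =
      (∑ j, MvPolynomial.X (i, j) * MvPolynomial.C (g j)) +
        -∑ j, (MvPolynomial.X (i, j) - MvPolynomial.C (a (i, j))) * MvPolynomial.C (g j) := by
    simp only [sub_mul, Finset.sum_sub_distrib, map_sum, map_mul]
    ring
  rw [SetLike.mem_coe, h]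
  refine Submodule.add_mem_sup (Ideal.subset_span ⟨i, rfl⟩) (neg_mem ?_)
  exact Ideal.sum_mem _ fun j _ => Ideal.mul_mem_mul (hM _)
    (Ideal.mem_map_of_mem _ (Ideal.subset_span ⟨j, rfl⟩))

/-- If a specialization of the generic ideal is a reduction, then so is the generic ideal
locally at the corresponding point. -/
theorem exists_notMem_mul_mem_genericIdeal_mul [IsNoetherianRing R] (g : Fin m → R)
    (a : Fin m × Fin m → R) (h : (combinationIdeal g a).IsReduction (Ideal.span (Set.range g)))
    {M : Ideal (MvPolynomial (Fin m × Fin m) R)} [M.IsPrime]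
    (hM : ∀ k, MvPolynomial.X k - MvPolynomial.C (a k) ∈ M) :
    ∃ r : ℕ, ∃ s ∉ M, ∀ x ∈ (Ideal.span (Set.range g) ^ (r + 1)).map MvPolynomial.C,
      s * x ∈ genericIdeal g * (Ideal.span (Set.range g) ^ r).map MvPolynomial.C := by
  obtain ⟨-, r, hr⟩ := h
  set I := Ideal.span (Set.range g) with hI
  have hle : (I ^ (r + 1)).map MvPolynomial.C ≤
      genericIdeal g * (I ^ r).map MvPolynomial.C ⊔ M • (I ^ (r + 1)).map MvPolynomial.C := by
    have h1 := Ideal.mul_mono_left (K := (I ^ r).map MvPolynomial.C)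
      (map_combinationIdeal_le g a hM)
    rw [Ideal.sup_mul, mul_assoc, ← Ideal.map_mul, ← Ideal.map_mul, ← hI, ← pow_succ', ← hr] at h1
    exact h1
  -- The determinant form of Nakayama gives `s ≡ 1` modulo `M`, hence `s ∉ M`.
  obtain ⟨s, hs, hs'⟩ := Submodule.exists_sub_one_mem_and_smul_le_of_fg_of_le_sup
    (IsNoetherian.noetherian _) le_rfl hle
  refine ⟨r, s, fun hsM => ?_, fun x hx => hs' (Submodule.smul_mem_pointwise_smul _ _ _ hx)⟩
  exact (Ideal.ne_top_iff_one M).1 ‹M.IsPrime›.ne_top (by simpa using M.sub_mem hsM hs)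

end Generic

section Generic

variable {R : Type*} [CommRing R] [IsNoetherianRing R] [IsLocalRing R] {m : ℕ}

/-- Near the point `a` the generic ideal is a reduction of the extension of `I`, so it agrees with
it at each prime whose contraction to `R` does not contain `c`. Hence `c` lies locally in the
radical of the colon; a power of `c` lies in it, and `u` clears denominators. -/
theorem exists_eval_isUnit_pow_mul_le_genericIdeal (g : Fin m → R) (c : Ideal R)
    (hc : ∀ (q : Ideal R) [q.IsPrime], ¬ c ≤ q → ∃ (n : ℕ) (f : Fin n → R),
      AnalyticallyIndependent q f ∧ (∀ i, f i ∈ Ideal.span (Set.range g)) ∧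
      ∃ t ∉ q, ∀ x ∈ Ideal.span (Set.range g), t * x ∈ Ideal.span (Set.range f))
    (a : Fin m × Fin m → R) (h : (combinationIdeal g a).IsReduction (Ideal.span (Set.range g))) :
    ∃ (n : ℕ) (u : MvPolynomial (Fin m × Fin m) R), IsUnit (MvPolynomial.eval a u) ∧
      u ∈ (genericIdeal g).colon
        ((c ^ n * Ideal.span (Set.range g)).map MvPolynomial.C :
          Ideal (MvPolynomial (Fin m × Fin m) R)) := by
  set I := Ideal.span (Set.range g) with hI
  let S := MvPolynomial (Fin m × Fin m) R
  -- The closed point of the parameter space given by `a`; being outside `M` means having unit value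
  -- at `a`.
  let M : Ideal S := (maximalIdeal R).comap (MvPolynomial.eval a)
  have : M.IsPrime := Ideal.comap_isPrime _ _
  obtain ⟨r, s, hs, hsI⟩ := exists_notMem_mul_mem_genericIdeal_mul g a h (M := M)
    (fun k => by simp [M])
  let k : Ideal S := (genericIdeal g).colon (I.map MvPolynomial.C : Ideal S)
  let B := Localization.AtPrime M
  have hrad : (c.map MvPolynomial.C).map (algebraMap S B) ≤ (k.map (algebraMap S B)).radical := by
    rw [Ideal.radical_eq_sInf]
    refine le_sInf fun P ⟨hkP, hP⟩ => ?_
    rw [Ideal.map_le_iff_le_comap] at hkP ⊢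
    let Q := P.comap (algebraMap S B)
    have hQ : Q.IsPrime := Ideal.comap_isPrime _ _
    have hQM : Q ≤ M := by
      intro x hx
      by_contra hxM
      exact hP.ne_top (Ideal.eq_top_of_isUnit_mem P hx
        (IsLocalization.map_units B (⟨x, hxM⟩ : M.primeCompl)))
    rw [Ideal.map_le_iff_le_comap]
    by_contra hcQ
    obtain ⟨n, f, hf, hfI, t, ht, htI⟩ := hc (Q.comap (algebraMap R S)) hcQ
    obtain ⟨u, hu, huI⟩ := hf.exists_notMem_mul_mem (IsNoetherian.noetherian I)
      (genericIdeal_le g) Q (fun hsQ => hs (hQM hsQ)) hsI hfI ht htI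
    exact hu (hkP (Submodule.mem_colon.2 fun z hz => huI z hz))
  obtain ⟨n, hn⟩ := Ideal.exists_pow_le_of_le_radical_of_fg hrad
    (Ideal.FG.map (Ideal.FG.map (IsNoetherian.noetherian c) _) _)
  rw [← Ideal.map_pow, ← Ideal.map_pow] at hn
  obtain ⟨u, hu, huk⟩ := Ideal.FG.exists_notMem_mul_mem_of_map_le (IsNoetherian.noetherian _) hn
  refine ⟨n, u, by simpa [M] using hu, Submodule.mem_colon.2 fun z hz => ?_⟩
  rw [SetLike.mem_coe, Ideal.map_mul] at hz
  induction hz using Submodule.mul_induction_on' with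
  | mem_mul_mem y hy w hw =>
    rw [smul_eq_mul, ← mul_assoc]
    exact Submodule.mem_colon.1 (huk y hy) w hw
  | add y _ w _ hy hw => rw [smul_add]; exact add_mem hy hw

/-- There is a uniform power of `c` that multiplies `I` into all reductions of `I` generated by a
bounded number of elements, if `I` is locally generated by analytically independent elements away
from the zero locus of `c`. -/
theorem exists_pow_mul_le_combinationIdeal (g : Fin m → R) (c : Ideal R)
    (hc : ∀ (q : Ideal R) [q.IsPrime], ¬ c ≤ q → ∃ (n : ℕ) (f : Fin n → R),
      AnalyticallyIndependent q f ∧ (∀ i, f i ∈ Ideal.span (Set.range g)) ∧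
      ∃ t ∉ q, ∀ x ∈ Ideal.span (Set.range g), t * x ∈ Ideal.span (Set.range f)) :
    ∃ N : ℕ, ∀ a, (combinationIdeal g a).IsReduction (Ideal.span (Set.range g)) →
      c ^ N * Ideal.span (Set.range g) ≤ combinationIdeal g a := by
  set I := Ideal.span (Set.range g) with hI
  let S := MvPolynomial (Fin m × Fin m) R
  -- The exponent `n` depends on `a`, but these colons do not; the index where the chain stabilizes
  -- serves every `a`.
  let d : ℕ →o Ideal S :=
    { toFun := fun n => (genericIdeal g).colon ((c ^ n * I).map MvPolynomial.C : Ideal S)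
      monotone' := fun i j hij => Submodule.colon_mono le_rfl
        (Ideal.map_mono (Ideal.mul_mono_left (Ideal.pow_le_pow_right hij))) }
  obtain ⟨N, hN⟩ := monotone_stabilizes_iff_noetherian.2 (inferInstance : IsNoetherian S S) d
  refine ⟨N, fun a ha y hy => ?_⟩
  obtain ⟨n, u, hu, hun⟩ := exists_eval_isUnit_pow_mul_le_genericIdeal g c hc a ha
  have huN : u ∈ d N := by
    rw [hN (max n N) (le_max_right _ _)]
    exact d.monotone (le_max_left n N) hun
  have h1 := genericIdeal_le_comap_eval g a
    (Submodule.mem_colon.1 huN (MvPolynomial.C y) (Ideal.mem_map_of_mem _ hy))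
  rw [Ideal.mem_comap, smul_eq_mul, map_mul, MvPolynomial.eval_C] at h1
  exact (Ideal.unit_mul_mem_iff_mem _ hu).1 h1

end Generic

/-! ### Reductions and the fiber I/𝔪I. -/

namespace Ideal

variable {R : Type*} [CommRing R]

theorem isReduction_refl (I : Ideal R) : I.IsReduction I := ⟨le_rfl, 0, by simp⟩

variable [IsLocalRing R] {I J : Ideal R}

/-- The fibre `I / 𝔪 I` of an ideal of a local ring. -/
abbrev FiberSpace (I : Ideal R) : Type _ := I ⧸ (maximalIdeal R • ⊤ : Submodule R I)

noncomputable instance : Field (R ⧸ maximalIdeal R) := Ideal.Quotient.field _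

/-- The image of `J ∩ I` in `I / 𝔪 I`. -/
noncomputable def fiberSpan (I J : Ideal R) : Submodule (R ⧸ maximalIdeal R) I.FiberSpace :=
  Submodule.span _ ((maximalIdeal R • ⊤ : Submodule R I).mkQ '' {x | (x : R) ∈ J})

theorem fiberSpan_mono (I : Ideal R) {J K : Ideal R} (h : J ≤ K) :
    fiberSpan I J ≤ fiberSpan I K :=
  Submodule.span_mono (Set.image_mono fun _ hx => h hx)

theorem mkQ_fiber_eq_zero_iff (x : I) :
    (maximalIdeal R • ⊤ : Submodule R I).mkQ x = 0 ↔ (x : R) ∈ maximalIdeal R * I := by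
  rw [Submodule.mkQ_apply, Submodule.Quotient.mk_eq_zero, Submodule.mem_smul_top_iff, smul_eq_mul]

theorem mem_sup_of_mkQ_mem_fiberSpan {x : I} (hx : (maximalIdeal R • ⊤ : Submodule R I).mkQ x ∈
    fiberSpan I J) : (x : R) ∈ J ⊔ maximalIdeal R * I := by
  suffices h : ∀ z ∈ fiberSpan I J, ∀ x : I, (maximalIdeal R • ⊤ : Submodule R I).mkQ x = z →
      (x : R) ∈ J ⊔ maximalIdeal R * I from h _ hx x rfl
  intro z hz
  induction hz using Submodule.span_induction with
  | mem z hz =>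
    obtain ⟨y, hy, rfl⟩ := hz
    intro x hx
    rw [← sub_eq_zero, ← map_sub, mkQ_fiber_eq_zero_iff] at hx
    have : (x : R) = y + (x - y : I) := by simp
    rw [this]
    exact Submodule.add_mem_sup hy hx
  | zero =>
    intro x hx
    exact le_sup_right (a := J) ((mkQ_fiber_eq_zero_iff x).1 hx)
  | add a b _ _ ha hb =>
    intro x hx
    obtain ⟨y, rfl⟩ := Submodule.mkQ_surjective _ a
    have h1 := ha y rfl
    have h2 := hb (x - y) (by rw [map_sub, hx, add_sub_cancel_left])
    simpa using add_mem h1 h2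
  | smul c a _ ha =>
    intro x hx
    obtain ⟨c, rfl⟩ := Ideal.Quotient.mk_surjective c
    obtain ⟨y, rfl⟩ := Submodule.mkQ_surjective _ a
    have h1 := Ideal.mul_mem_left _ c (ha y rfl)
    have h3 : (maximalIdeal R • ⊤ : Submodule R I).mkQ (x - c • y) = 0 := by
      rw [map_sub, hx, map_smul, sub_eq_zero]; rfl
    have h2 := le_sup_right (a := J) ((mkQ_fiber_eq_zero_iff _).1 h3)
    simpa using add_mem h1 h2

variable [IsNoetherianRing R]

/-- By Nakayama's lemma, being a reduction can be tested modulo `𝔪 I`. -/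
theorem IsReduction.of_le_sup (hJ : J.IsReduction I) {K : Ideal R} (hKI : K ≤ I)
    (h : J ≤ K ⊔ maximalIdeal R * I) : K.IsReduction I := by
  obtain ⟨-, r, hr⟩ := hJ
  refine ⟨hKI, r, le_antisymm ?_ ?_⟩
  · refine Submodule.le_of_le_smul_of_le_jacobson_bot (I := maximalIdeal R)
      (IsNoetherian.noetherian _) (maximalIdeal_le_jacobson _) ?_
    have := Ideal.mul_mono_left (K := I ^ r) h
    rwa [Ideal.sup_mul, mul_assoc, ← pow_succ', ← hr] at this
  · rw [pow_succ']
    exact Ideal.mul_mono_left hKI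

/-- Lift to `J` a basis of its image in I/𝔪I. Linear independence of the basis is the final clause.
-/
theorem exists_fiberSpan_generators (hJ : J ≤ I) :
    ∃ (d : ℕ) (h : Fin d → R), d = Module.finrank (R ⧸ maximalIdeal R) (fiberSpan I J) ∧
      (∀ i, h i ∈ J) ∧ J ≤ span (Set.range h) ⊔ maximalIdeal R * I ∧
      fiberSpan I (span (Set.range h)) = fiberSpan I J ∧
      ∀ c : Fin d → R,
        ∑ i, c i * h i ∈ maximalIdeal R * I → ∀ i, c i ∈ maximalIdeal R := by
  obtain ⟨v, hv, hspan, hind⟩ : ∃ v : Fin (Module.finrank (R ⧸ maximalIdeal R) (fiberSpan I J)) →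
      I.FiberSpace, (∀ i, v i ∈ (maximalIdeal R • ⊤ : Submodule R I).mkQ '' {x | (x : R) ∈ J}) ∧
      Submodule.span (R ⧸ maximalIdeal R) (Set.range v) = fiberSpan I J ∧
      LinearIndependent (R ⧸ maximalIdeal R) v := Submodule.exists_fun_fin_finrank_span_eq (R ⧸ maximalIdeal R)
    ((maximalIdeal R • ⊤ : Submodule R I).mkQ '' {x | (x : R) ∈ J})
  choose h hJh hh using hv
  have hle : span (Set.range fun i => (h i : R)) ≤ J := by
    rw [span_le]
    rintro _ ⟨i, rfl⟩
    exact hJh i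
  have heq : fiberSpan I (span (Set.range fun i => (h i : R))) = fiberSpan I J := by
    refine le_antisymm (fiberSpan_mono I hle) ?_
    refine hspan.ge.trans (Submodule.span_mono ?_)
    rintro _ ⟨i, rfl⟩
    exact ⟨h i, subset_span ⟨i, rfl⟩, hh i⟩
  refine ⟨_, fun i => h i, rfl, hJh, fun x hx => ?_, heq, fun c hc i => ?_⟩
  · refine mem_sup_of_mkQ_mem_fiberSpan (x := ⟨x, hJ hx⟩) ?_
    rw [heq]
    exact Submodule.subset_span ⟨_, hx, rfl⟩
  · have h0 : (maximalIdeal R • ⊤ : Submodule R I).mkQ (∑ i, c i • h i) = 0 := by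
      rw [mkQ_fiber_eq_zero_iff]
      simpa using hc
    have h1 : ∑ i, (Ideal.Quotient.mk (maximalIdeal R) (c i)) • v i = 0 := by
      rw [← h0, map_sum]
      refine Finset.sum_congr rfl fun i _ => ?_
      rw [map_smul, hh]; rfl
    exact Ideal.Quotient.eq_zero_iff_mem.1 (Fintype.linearIndependent_iff.1 hind _ h1 i)

theorem finrank_fiberSpan_le {m : ℕ} (g : Fin m → R) (hg : span (Set.range g) = I)
    (J : Ideal R) : Module.finrank (R ⧸ maximalIdeal R) (fiberSpan I J) ≤ m := by
  have hgI : ∀ i, g i ∈ I := fun i => hg ▸ subset_span ⟨i, rfl⟩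
  let w : Fin m → I.FiberSpace := fun i => (maximalIdeal R • ⊤ : Submodule R I).mkQ ⟨g i, hgI i⟩
  have htop : Submodule.span (R ⧸ maximalIdeal R) (Set.range w) = ⊤ := by
    rw [eq_top_iff]
    rintro z -
    obtain ⟨⟨x, hx⟩, rfl⟩ := Submodule.mkQ_surjective _ z
    obtain ⟨c, hc⟩ := (mem_span_range_iff_exists_fun (R := R)).1 (hg.symm ▸ hx)
    have : (⟨x, hx⟩ : I) = ∑ i, c i • ⟨g i, hgI i⟩ := by
      apply Subtype.ext
      simp [← hc]
    rw [this, map_sum]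
    exact Submodule.sum_mem _ fun i _ => Submodule.smul_mem _ (Ideal.Quotient.mk _ (c i))
      (Submodule.subset_span (Set.mem_range_self i))
  calc _ ≤ Module.finrank (R ⧸ maximalIdeal R) I.FiberSpace := Submodule.finrank_le _
    _ = Module.finrank (R ⧸ maximalIdeal R) (Submodule.span (R ⧸ maximalIdeal R) (Set.range w)) := by
      rw [htop, finrank_top]
    _ ≤ m := by
      simpa [Set.finrank] using finrank_range_le_card (R := R ⧸ maximalIdeal R) w

/-- Every reduction of an ideal generated by `m` elements contains a reduction generated by `m`
linear combinations of these. -/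
theorem IsReduction.exists_combinationIdeal_le {m : ℕ} (g : Fin m → R)
    (hJ : J.IsReduction (span (Set.range g))) :
    ∃ a, (combinationIdeal g a).IsReduction (span (Set.range g)) ∧ combinationIdeal g a ≤ J := by
  obtain ⟨d, h, hd', hhJ, hJh, -⟩ := exists_fiberSpan_generators hJ.1
  have hd : d ≤ m := hd' ▸ finrank_fiberSpan_le g rfl J
  -- Since `d ≤ m`, the `d` generators are padded with zeros to `m` combinations.
  have hc : ∀ i : Fin m, ∃ c : Fin m → R,
      ∑ j, c j * g j = if hi : i.1 < d then h ⟨i, hi⟩ else 0 := fun i => by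
    have : (if hi : i.1 < d then h ⟨i, hi⟩ else 0) ∈ span (Set.range g) := by
      split_ifs
      · exact hJ.1 (hhJ _)
      · exact zero_mem _
    exact mem_span_range_iff_exists_fun.1 this
  choose c hc using hc
  have hle : combinationIdeal g (fun k => c k.1 k.2) ≤ J := by
    rw [combinationIdeal, span_le]
    rintro _ ⟨i, rfl⟩
    simp only [hc]
    split_ifs
    · exact hhJ _
    · exact zero_mem _
  refine ⟨fun k => c k.1 k.2, hJ.of_le_sup (hle.trans hJ.1) (hJh.trans (sup_le_sup_right ?_ _)),
    hle⟩
  rw [span_le]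
  rintro _ ⟨i, rfl⟩
  refine subset_span ⟨⟨i, i.2.trans_le hd⟩, ?_⟩
  simp [hc]

/-- Every reduction contains a minimal reduction. -/
theorem IsReduction.exists_isMinimalReduction_le (hJ : J.IsReduction I) :
    ∃ K : Ideal R, K.IsMinimalReduction I ∧ K ≤ J := by
  -- Choose a reduction with smallest image in I/𝔪I and keep only lifts of a basis of that image. A
  -- smaller reduction `L` has the same image, and elements of the span lying in 𝔪I have
  -- coefficients in 𝔪, so Nakayama gives equality.
  obtain ⟨K, ⟨hK, hKJ⟩, hmin⟩ := (measure fun K : Ideal R =>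
    Module.finrank (R ⧸ maximalIdeal R) (fiberSpan I K)).wf.has_min
      {K | K.IsReduction I ∧ K ≤ J} ⟨J, hJ, le_rfl⟩
  obtain ⟨d, h, -, hhK, hKh, hspan, hind⟩ := exists_fiberSpan_generators hK.1
  have hle : span (Set.range h) ≤ K := by
    rw [span_le]
    rintro _ ⟨i, rfl⟩
    exact hhK i
  have hred : (span (Set.range h)).IsReduction I := hK.of_le_sup (hle.trans hK.1) hKh
  refine ⟨span (Set.range h), ⟨hred, fun L hL hLh => ?_⟩, hle.trans hKJ⟩
  have h1 : fiberSpan I L = fiberSpan I K := by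
    refine Submodule.eq_of_le_of_finrank_le (fiberSpan_mono I (hLh.trans hle)) ?_
    exact not_lt.1 (hmin L ⟨hL, hLh.trans (hle.trans hKJ)⟩)
  refine Submodule.le_of_le_smul_of_le_jacobson_bot (I := maximalIdeal R)
    (IsNoetherian.noetherian _) (maximalIdeal_le_jacobson _) fun x hx => ?_
  have h2 : x ∈ L ⊔ maximalIdeal R * I :=
    mem_sup_of_mkQ_mem_fiberSpan (x := ⟨x, hred.1 hx⟩)
      (h1 ▸ Submodule.subset_span (Set.mem_image_of_mem _ (show (⟨x, hred.1 hx⟩ : I) ∈ {z : I | (z : R) ∈ K} from hle hx)))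
  obtain ⟨l, hl, y, hy, rfl⟩ := Submodule.mem_sup.1 h2
  refine Submodule.add_mem_sup hl ?_
  have hy' : y ∈ span (Set.range h) := by simpa using sub_mem hx (hLh hl)
  obtain ⟨c, rfl⟩ := mem_span_range_iff_exists_fun.1 hy'
  exact Submodule.sum_mem _ fun i _ => Submodule.smul_mem_smul (hind c hy i)
    (subset_span ⟨i, rfl⟩)

end Ideal

/-! ### The Artinian localization and the core. -/

/-- A prime over the extended power contracts into a member of `P` by prime avoidance and also
contains a member of `P`; minimality makes it equal to one. So the quotient has no strict inclusions
of primes. -/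
theorem isArtinianRing_quotient_pow_vanishingIdeal {R : Type*} [CommRing R] [IsNoetherianRing R]
    {P : Set (PrimeSpectrum R)} (hP : P.Finite)
    (hmin : ∀ p ∈ P, Minimal (fun q => q ∈ P) p) (N : ℕ) :
    IsArtinianRing (Localization (⨅ p ∈ P, p.asIdeal.primeCompl) ⧸
      ((PrimeSpectrum.vanishingIdeal P) ^ N).map
        (algebraMap R (Localization (⨅ p ∈ P, p.asIdeal.primeCompl)))) := by
  set T : Submonoid R := ⨅ p ∈ P, p.asIdeal.primeCompl with hT
  let A := Localization T
  have : IsNoetherianRing A := IsLocalization.isNoetherianRing T A inferInstance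
  set b := ((PrimeSpectrum.vanishingIdeal P) ^ N).map (algebraMap R A) with hb
  have hcontr : ∀ Q : Ideal A, Q.IsPrime → b ≤ Q →
      ∃ p ∈ P, Q.comap (algebraMap R A) = p.asIdeal := by
    intro Q hQ hbQ
    have hq : (Q.comap (algebraMap R A)).IsPrime := Ideal.comap_isPrime _ _
    have h1 : ∃ p ∈ hP.toFinset, Q.comap (algebraMap R A) ≤ p.asIdeal := by
      by_cases hne : P.Nonempty
      · obtain ⟨p₀, -⟩ := hne
        refine (Ideal.subset_union_prime (f := PrimeSpectrum.asIdeal) p₀ p₀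
          (fun p _ _ _ => p.isPrime)).1 fun x hx => ?_
        by_contra hxP
        simp only [Set.Finite.coe_toFinset, Set.mem_iUnion, not_exists] at hxP
        have hxT : x ∈ T := by
          simp only [hT, Submonoid.mem_iInf]
          exact fun p hp => hxP p hp
        exact hQ.ne_top (Ideal.eq_top_of_isUnit_mem Q hx
          (IsLocalization.map_units A (⟨x, hxT⟩ : T)))
      -- For empty `P`, `T` is all of `R` and the localization is zero.
      · have hxT : (0 : R) ∈ T := by
          simp only [hT, Submonoid.mem_iInf]
          exact fun p hp => absurd ⟨p, hp⟩ hne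
        exact absurd (Ideal.eq_top_of_isUnit_mem Q (by simp)
          (IsLocalization.map_units A (⟨0, hxT⟩ : T))) hQ.ne_top
    obtain ⟨p, hp, hQp⟩ := h1
    rw [Set.Finite.mem_toFinset] at hp
    have h2 : PrimeSpectrum.vanishingIdeal P ≤ Q.comap (algebraMap R A) :=
      hq.le_of_pow_le (Ideal.map_le_iff_le_comap.1 hbQ)
    obtain ⟨p', hp', hp'Q⟩ : ∃ p' ∈ hP.toFinset, p'.asIdeal ≤ Q.comap (algebraMap R A) := by
      refine (Ideal.IsPrime.inf_le' hq).1 (le_trans ?_ h2)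
      intro x hx
      rw [PrimeSpectrum.mem_vanishingIdeal]
      exact fun p hp => (Finset.inf_le (hP.mem_toFinset.2 hp) : _ ≤ p.asIdeal) hx
    rw [Set.Finite.mem_toFinset] at hp'
    have h3 : p ≤ p' := (hmin p hp).2 hp' (show p'.asIdeal ≤ p.asIdeal from hp'Q.trans hQp)
    exact ⟨p, hp, le_antisymm hQp (le_trans h3 hp'Q)⟩
  rw [isArtinianRing_iff_isNoetherianRing_krullDimLE_zero]
  refine ⟨inferInstance, Ring.KrullDimLE.mk₀ fun Q hQ => ?_⟩
  obtain ⟨M, hM, hQM⟩ := Ideal.exists_le_maximal Q hQ.ne_top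
  suffices Q = M by rwa [this]
  have hcomap : ∀ Q : Ideal (A ⧸ b), Q.IsPrime → ∃ p ∈ P,
      (Q.comap (Ideal.Quotient.mk b)).comap (algebraMap R A) = p.asIdeal := fun Q hQ =>
    hcontr _ (Ideal.comap_isPrime _ _) (by
      conv_lhs => rw [← Ideal.mk_ker (I := b)]
      exact Ideal.comap_mono bot_le)
  obtain ⟨p, hp, hpQ⟩ := hcomap Q hQ
  obtain ⟨p', hp', hpM⟩ := hcomap M hM.isPrime
  have h4 : p.asIdeal ≤ p'.asIdeal := hpQ ▸ hpM ▸ Ideal.comap_mono (Ideal.comap_mono hQM)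
  have h5 : p'.asIdeal ≤ p.asIdeal := (hmin p' hp').2 hp h4
  have h6 := hpQ.trans ((le_antisymm h4 h5).trans hpM.symm)
  have h7 := congrArg (Ideal.map (algebraMap R A)) h6
  rw [IsLocalization.map_under T A, IsLocalization.map_under T A] at h7
  exact Ideal.comap_injective_of_surjective _ Ideal.Quotient.mk_surjective h7

/-- Modulo an ideal with Artinian quotient, there is no infinite strictly descending chain of
ideals. -/
theorem Ideal.exists_forall_not_lt_of_isArtinianRing {A ι : Type*} [CommRing A] [Nonempty ι]
    (b I : Ideal A) (hI : I.FG) [IsArtinianRing (A ⧸ b)] (K : ι → Ideal A)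
    (hbK : ∀ i, b * I ≤ K i) (hKI : ∀ i, K i ≤ I) : ∃ i, ∀ j, ¬ K j < K i := by
  -- I/bI is finite over the Artinian ring A/b, and each `K i`, containing bI, is determined by its
  -- image there.
  let M := I ⧸ (b • ⊤ : Submodule A I)
  have : Module.Finite A I := Module.Finite.iff_fg.2 hI
  have : Module.Finite (A ⧸ b) M := Module.Finite.of_restrictScalars_finite A _ _
  have : IsArtinian (A ⧸ b) M := inferInstance
  have : IsArtinian A M :=
    isArtinian_of_surjective_algebraMap (R := A ⧸ b) Ideal.Quotient.mk_surjective
  let φ : ι → Submodule A M := fun i => Submodule.map (b • ⊤ : Submodule A I).mkQ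
    ((K i).submoduleOf I)
  obtain ⟨i, -, hi⟩ := (InvImage.wf φ (wellFounded_lt (α := Submodule A M))).has_min
    Set.univ Set.univ_nonempty
  refine ⟨i, fun j hji => hi j trivial (lt_of_le_of_ne ?_ fun heq => hji.not_ge fun x hx => ?_)⟩
  · exact Submodule.map_mono fun x hx => hji.le hx
  · have h1 : (b • ⊤ : Submodule A I).mkQ ⟨x, hKI i hx⟩ ∈ φ j :=
      heq ▸ Submodule.mem_map_of_mem (show (⟨x, hKI i hx⟩ : I) ∈ (K i).submoduleOf I from hx)
    obtain ⟨y, hy, hyx⟩ := h1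
    rw [← sub_eq_zero, ← map_sub, Submodule.mkQ_apply, Submodule.Quotient.mk_eq_zero,
      Submodule.mem_smul_top_iff] at hyx
    have h2 := sub_mem (show (y : A) ∈ K j from hy) (hbK j hyx)
    simpa using h2

/-- Zero divisors on I/J lie in associated primes, all of which `s` avoids. -/
theorem Ideal.IsMinimalReduction.mem_of_mul_mem {R : Type*} [CommRing R] [IsNoetherianRing R]
    {I J : Ideal R} (hJ : J.IsMinimalReduction I) {s x : R}
    (hs : s ∈ (⨅ p ∈ I.reductionPrimes, p.asIdeal.primeCompl : Submonoid R)) (hx : x ∈ I)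
    (hsx : s * x ∈ J) : x ∈ J := by
  by_contra hxJ
  have h1 : s ∈ ⋃ p ∈ associatedPrimes R (I ⧸ J.submoduleOf I), (p : Set R) := by
    rw [biUnion_associatedPrimes_eq_zero_divisors]
    refine ⟨(J.submoduleOf I).mkQ ⟨x, hx⟩, ?_, ?_⟩
    · rw [Ne, Submodule.mkQ_apply, Submodule.Quotient.mk_eq_zero]
      exact hxJ
    · rw [← map_smul, Submodule.mkQ_apply, Submodule.Quotient.mk_eq_zero]
      exact hsx
  simp only [Set.mem_iUnion] at h1
  obtain ⟨p, hp, hsp⟩ := h1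
  simp only [Submonoid.mem_iInf] at hs
  exact hs ⟨p, hp.isPrime⟩ ⟨J, hJ, hp⟩ hsp

/-- The finite intersections of minimal reductions of `I`. -/
def Ideal.finiteMinimalReductionInfs {R : Type*} [CommRing R] (I : Ideal R) : Set (Ideal R) :=
  {K | ∃ n : ℕ, 0 < n ∧ ∃ J : Fin n → Ideal R, (∀ i, (J i).IsMinimalReduction I) ∧ K = ⨅ i, J i}

theorem Ideal.inf_mem_finiteMinimalReductionInfs {R : Type*} [CommRing R] {I K L : Ideal R}
    (hK : K ∈ I.finiteMinimalReductionInfs) (hL : L.IsMinimalReduction I) :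
    L ⊓ K ∈ I.finiteMinimalReductionInfs := by
  obtain ⟨n, hn, J, hJ, rfl⟩ := hK
  refine ⟨n + 1, n.succ_pos, Fin.cons L J, Fin.cases hL hJ, le_antisymm ?_ ?_⟩
  · exact le_iInf (Fin.cases inf_le_left fun i => inf_le_right.trans (iInf_le J i))
  · exact le_inf (iInf_le (Fin.cons L J : Fin (n + 1) → Ideal R) 0)
      (le_iInf fun i => iInf_le (Fin.cons L J : Fin (n + 1) → Ideal R) i.succ)

theorem theorem3p1 {R : Type*} [CommRing R] [IsLocalRing R] [IsNoetherianRing R]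
    [Infinite (IsLocalRing.ResidueField R)] (I : Ideal R)
    (hfin : I.reductionPrimes.Finite)
    (hmin : ∀ p ∈ I.reductionPrimes, Minimal (fun q => q ∈ I.reductionPrimes) p)
    (hgen : ∀ q : PrimeSpectrum R, q ∉ closure I.reductionPrimes →
      ((I.map (algebraMap R (Localization.AtPrime q.asIdeal))).spanFinrank : WithBot ℕ∞) =
        (I.map (algebraMap R (Localization.AtPrime q.asIdeal))).analyticSpread) :
    I.gamma < ⊤ := by
  set c := PrimeSpectrum.vanishingIdeal I.reductionPrimes with hc
  obtain ⟨m, g, hg⟩ := Submodule.fg_iff_exists_fin_generating_family.1 (IsNoetherian.noetherian I)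
  obtain ⟨N, hN⟩ := exists_pow_mul_le_combinationIdeal g c (by
    intro q hq hcq
    rw [show Ideal.span (Set.range g) = I from hg]
    refine exists_analyticallyIndependent_of_spanFinrank_eq I q (hgen ⟨q, hq⟩ fun hcl => hcq ?_)
    rw [← PrimeSpectrum.zeroLocus_vanishingIdeal_eq_closure] at hcl
    exact hcl)
  have hNJ : ∀ J : Ideal R, J.IsReduction I → c ^ N * I ≤ J := by
    intro J hJ
    obtain rfl : Ideal.span (Set.range g) = I := hg
    obtain ⟨a, ha, haJ⟩ := hJ.exists_combinationIdeal_le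
    exact (hN a ha).trans haJ
  let T : Submonoid R := ⨅ p ∈ I.reductionPrimes, p.asIdeal.primeCompl
  let A := Localization T
  have : IsArtinianRing (A ⧸ (c ^ N).map (algebraMap R A)) :=
    isArtinianRing_quotient_pow_vanishingIdeal hfin hmin N
  obtain ⟨J₀, hJ₀, -⟩ := I.isReduction_refl.exists_isMinimalReduction_le
  have : Nonempty I.finiteMinimalReductionInfs :=
    ⟨⟨J₀, 1, one_pos, fun _ => J₀, fun _ => hJ₀, (iInf_const).symm⟩⟩
  have hle : ∀ K ∈ I.finiteMinimalReductionInfs, c ^ N * I ≤ K ∧ K ≤ I := by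
    rintro _ ⟨n, hn, J, hJ, rfl⟩
    exact ⟨le_iInf fun i => hNJ _ (hJ i).1, (iInf_le J ⟨0, hn⟩).trans (hJ _).1.1⟩
  obtain ⟨⟨K, hK⟩, hKmin⟩ := Ideal.exists_forall_not_lt_of_isArtinianRing
    ((c ^ N).map (algebraMap R A)) (I.map (algebraMap R A))
    (Ideal.FG.map (IsNoetherian.noetherian I) _)
    (fun K : I.finiteMinimalReductionInfs => K.1.map (algebraMap R A))
    (fun K => by rw [← Ideal.map_mul]; exact Ideal.map_mono (hle K K.2).1)
    (fun K => Ideal.map_mono (hle K K.2).2)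
  have hcore : I.core = K := by
    obtain ⟨n, hn, J, hJ, hKJ⟩ := id hK
    refine le_antisymm ?_ (le_sInf fun L hL => ?_)
    · rw [hKJ]
      exact le_iInf fun i => sInf_le (hJ i).1
    · obtain ⟨L', hL', hL'L⟩ := Ideal.IsReduction.exists_isMinimalReduction_le hL
      refine le_trans (fun x hx => ?_) hL'L
      -- Minimality of `K` controls only its extension to `A`; the multiplier `s` found next is
      -- cancelled modulo `L'`.
      have h1 : K.map (algebraMap R A) ≤ (L' ⊓ K).map (algebraMap R A) := by
        by_contra h
        exact hKmin ⟨L' ⊓ K, Ideal.inf_mem_finiteMinimalReductionInfs hK hL'⟩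
          (lt_of_le_not_ge (Ideal.map_mono inf_le_right) h)
      obtain ⟨s, hs, hsx⟩ := (IsLocalization.algebraMap_mem_map_algebraMap_iff T A _ _).1
        (h1 (Ideal.mem_map_of_mem _ hx))
      exact hL'.mem_of_mul_mem hs ((hle K hK).2 hx) hsx.1
  obtain ⟨n, hn, J, hJ, hKJ⟩ := hK
  refine lt_of_le_of_lt (sInf_le ⟨n, rfl, hn, J, hJ, hcore.trans hKJ⟩) (WithTop.coe_lt_top n)
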